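/- Let $R$ be a commutative local noetherian profinite ring, let $G$ be a finite group, and let $M_1,\dots,M_s$ be finitely many pairwise non-isomorphic finitely generated indecomposable left $RG$-modules, each with its unique topology as a profinite $RG$-module. Put $M=\bigoplus_{i=1}^s M_i$ and $E=\operatorname{End}_{RG}(M)$, and give $E$ and all $\operatorname{Hom}_{RG}(M,U)$ (for $U$ a topological $RG$-module) the compact-open topology; $\operatorname{Hom}_{RG}(M,U)$ is a right $E$-module by precomposition. Let $\operatorname{Add}(M)$ be the category of topological $RG$-modules isomorphic to one of the form $\bigoplus_{i=1}^s\prod_{\kappa_i}M_i$ (product topology), where the $\kappa_i$ are arbitrary cardinals, with continuous $RG$-homomorphisms as morphisms. Let $\operatorname{Proj}(E)$ be the category of profinite right $E$-modules that are projective, i.e. such that continuous homomorphisms out of them lift along continuous surjective homomorphisms of profinite right $E$-modules, with continuous $E$-homomorphisms as morphisms. Then $U\mapsto \operatorname{Hom}_{RG}(M,U)$ (on morphisms: composition $\alpha\mapsto\alpha\circ -$) sends objects of $\operatorname{Add}(M)$ to objects of $\operatorname{Proj}(E)$ and is an equivalence of categories $\operatorname{Add}(M)\to\operatorname{Proj}(E)$.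 In particular, $\operatorname{Add}(M)$ and $\operatorname{Proj}(E)$ are equivalent. -/

import Mathlib

open CategoryTheory

universe u v w

namespace ProfMod

section GroupRing

variable {R : Type u} {G : Type v} [CommRing R] [TopologicalSpace R]

/-- For a finite group `G`, the group ring `RG = ⨁_{g ∈ G} R` carries the product topology,
that is, the coarsest topology for which all the coefficient maps `RG → R` are continuous. -/
instance groupRingTopology : TopologicalSpace (MonoidAlgebra R G) :=
  TopologicalSpace.induced (fun x (g : G) => x.coeff g) inferInstance

theorem continuous_coeff (g : G) : Continuous fun x : MonoidAlgebra R G => x.coeff g :=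
  (continuous_apply g).comp continuous_induced_dom

instance groupRing_isTopologicalRing [IsTopologicalRing R] [Group G] [Finite G] :
    IsTopologicalRing (MonoidAlgebra R G) where
  continuous_add := by
    refine continuous_induced_rng.2 (continuous_pi fun g => ?_)
    have h : Continuous fun p : MonoidAlgebra R G × MonoidAlgebra R G =>
        p.1.coeff g + p.2.coeff g :=
      ((continuous_coeff g).comp continuous_fst).add ((continuous_coeff g).comp continuous_snd)
    exact h
  continuous_neg := by
    refine continuous_induced_rng.2 (continuous_pi fun g => ?_)
    have h : Continuous fun p : MonoidAlgebra R G => -p.coeff g := (continuous_coeff g).neg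
    exact h
  continuous_mul := by
    cases nonempty_fintype G
    refine continuous_induced_rng.2 (continuous_pi fun g => ?_)
    have h : Continuous fun p : MonoidAlgebra R G × MonoidAlgebra R G =>
        ∑ k : G, p.1.coeff k * p.2.coeff (k⁻¹ * g) :=
      continuous_finsetSum _ fun k _ =>
        ((continuous_coeff k).comp continuous_fst).mul
          ((continuous_coeff (k⁻¹ * g)).comp continuous_snd)
    refine h.congr fun p => ?_
    change _ = (p.1 * p.2).coeff g
    rw [MonoidAlgebra.coeff_mul_apply_left, Finsupp.sum_fintype _ _ (by simp)]

instance groupRing_compactSpace [CompactSpace R] [Finite G] :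
    CompactSpace (MonoidAlgebra R G) := by
  have hs : Function.Surjective (fun (x : MonoidAlgebra R G) (g : G) => x.coeff g) := fun y =>
    ⟨⟨Finsupp.equivFunOnFinite.symm y⟩, rfl⟩
  have hi : Topology.IsInducing (fun (x : MonoidAlgebra R G) (g : G) => x.coeff g) := ⟨rfl⟩
  refine ⟨(hi.isCompact_iff).2 ?_⟩
  rw [Set.image_univ, hs.range_eq]
  exact isCompact_univ

end GroupRing

section Hom

variable {A : Type u} [Ring A]
variable {M : Type v} [AddCommGroup M] [Module A M] [TopologicalSpace M]
variable {U : Type w} [AddCommGroup U] [Module A U] [TopologicalSpace U]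

/-- The compact-open topology on `Hom_A(M, U)`. (It is used below only for finitely generated
modules `M` with their module topology; all `A`-linear maps `M → U` into a topological module are
then continuous.) -/
instance homTopology : TopologicalSpace (M →ₗ[A] U) :=
  TopologicalSpace.generateFrom
    {s | ∃ (K : Set M) (V : Set U), IsCompact K ∧ IsOpen V ∧ s = {f : M →ₗ[A] U | Set.MapsTo f K V}}

/-- `Hom_A(M, U)` is a right module over `End_A(M)` by precomposition: `f · e = f ∘ e`. -/
instance homRightModule : Module (Module.End A M)ᵐᵒᵖ (M →ₗ[A] U) where
  smul e f := f.comp e.unop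
  one_smul _ := LinearMap.ext fun _ => rfl
  mul_smul _ _ _ := LinearMap.ext fun _ => rfl
  smul_zero _ := LinearMap.ext fun _ => rfl
  smul_add _ _ _ := LinearMap.ext fun _ => rfl
  add_smul _ _ f := LinearMap.ext fun _ => map_add f _ _
  zero_smul f := LinearMap.ext fun _ => map_zero f

variable [TopologicalSpace A]

/-- The compact-open topology as the one induced from the space of continuous maps. -/
theorem isInducing_toContinuousMap [IsModuleTopology A M] [ContinuousAdd U] [ContinuousSMul A U] :
    Topology.IsInducing (fun f : M →ₗ[A] U =>
      (⟨f, IsModuleTopology.continuous_of_linearMap f⟩ : C(M, U))) := by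
  refine ⟨?_⟩
  rw [ContinuousMap.compactOpen, induced_generateFrom_eq]
  refine congrArg TopologicalSpace.generateFrom (Set.ext fun s => ?_)
  constructor
  · rintro ⟨K, V, hK, hV, rfl⟩
    exact ⟨_, ⟨K, hK, V, hV, rfl⟩, rfl⟩
  · rintro ⟨_, ⟨K, hK, V, hV, rfl⟩, rfl⟩
    exact ⟨K, V, hK, hV, rfl⟩

theorem compactSpace_of_finite [IsTopologicalRing A] [CompactSpace A] [IsModuleTopology A M]
    [Module.Finite A M] : CompactSpace M := by
  obtain ⟨n, f, hf⟩ := Module.Finite.exists_fin' A M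
  have := IsModuleTopology.toContinuousAdd A M
  have hc : Continuous f := IsModuleTopology.continuous_of_linearMap f
  refine ⟨?_⟩
  rw [← hf.range_eq]
  exact isCompact_range hc

instance hom_continuousAdd [IsModuleTopology A M] [IsTopologicalAddGroup U] [ContinuousSMul A U] :
    ContinuousAdd (M →ₗ[A] U) where
  continuous_add := by
    have hi := isInducing_toContinuousMap (A := A) (M := M) (U := U)
    rw [hi.continuous_iff]
    exact (hi.continuous.comp continuous_fst).add (hi.continuous.comp continuous_snd)

theorem hom_continuousSMul [IsTopologicalRing A] [CompactSpace A] [IsModuleTopology A M]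
    [Module.Finite A M] [ContinuousAdd U] [ContinuousSMul A U] :
    ContinuousSMul (Module.End A M)ᵐᵒᵖ (M →ₗ[A] U) where
  continuous_smul := by
    have := compactSpace_of_finite (A := A) (M := M)
    have := IsModuleTopology.topologicalAddGroup A M
    have hU := isInducing_toContinuousMap (A := A) (M := M) (U := U)
    have hM := isInducing_toContinuousMap (A := A) (M := M) (U := M)
    rw [hU.continuous_iff]
    exact ContinuousMap.continuous_comp'.comp
      ((hM.continuous.comp (MulOpposite.continuous_unop.comp continuous_fst)).prodMk
        (hU.continuous.comp continuous_snd))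

/-- Postcomposition with a continuous homomorphism, as a continuous homomorphism of right
`End_A(M)`-modules. -/
def postcomp (M : Type v) [AddCommGroup M] [Module A M] [TopologicalSpace M]
    {U V : Type w} [AddCommGroup U] [Module A U] [TopologicalSpace U]
    [AddCommGroup V] [Module A V] [TopologicalSpace V] (α : U →L[A] V) :
    (M →ₗ[A] U) →L[(Module.End A M)ᵐᵒᵖ] (M →ₗ[A] V) where
  toFun f := α.toLinearMap.comp f
  map_add' _ _ := LinearMap.ext fun _ => map_add α _ _
  map_smul' _ _ := LinearMap.ext fun _ => rfl
  cont := by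
    refine continuous_generateFrom_iff.2 ?_
    rintro _ ⟨K, V', hK, hV, rfl⟩
    exact TopologicalSpace.isOpen_generateFrom_of_mem
      ⟨K, α ⁻¹' V', hK, hV.preimage α.continuous, rfl⟩

/-- For a finitely generated left module `M` (with its module topology) over a compact topological
ring `A`, the functor `Hom_A(M, -)` from topological left `A`-modules to topological right
modules over `E = End_A(M)`, i.e. left modules over the opposite ring of `E`. -/
noncomputable def homFunctor (A : Type u) [Ring A] [TopologicalSpace A] [IsTopologicalRing A]
    [CompactSpace A] (M : Type w) [AddCommGroup M] [Module A M] [TopologicalSpace M]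
    [IsModuleTopology A M] [Module.Finite A M] :
    TopModuleCat.{w} A ⥤ TopModuleCat.{w} (Module.End A M)ᵐᵒᵖ where
  obj U :=
    have : ContinuousSMul (Module.End A M)ᵐᵒᵖ (M →ₗ[A] U) := hom_continuousSMul
    TopModuleCat.of (Module.End A M)ᵐᵒᵖ (M →ₗ[A] U)
  map α :=
    have : ∀ W : TopModuleCat.{w} A, ContinuousSMul (Module.End A M)ᵐᵒᵖ (M →ₗ[A] W) :=
      fun _ => hom_continuousSMul
    TopModuleCat.ofHom (postcomp M α.hom)
  map_id _ := rfl
  map_comp _ _ := rfl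

end Hom

section Categories

/-- A module is indecomposable if it is nonzero and is not an internal direct sum of two nonzero
submodules. -/
def IsIndecomposable (A : Type u) [Ring A] (M : Type w) [AddCommGroup M] [Module A M] : Prop :=
  Nontrivial M ∧ ∀ N N' : Submodule A M, IsCompl N N' → N = ⊥ ∨ N' = ⊥

/-- The objects of `Add(M)`, `M = ⨁ i, M i`, among all topological `A`-modules: those of the form
`⨁ i, ∏_{κ i} M i` for cardinals (index sets) `κ i`, up to topological isomorphism. -/
def IsAdd (A : Type u) [Ring A] [TopologicalSpace A] {s : ℕ} (M : Fin s → Type w)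
    [∀ i, AddCommGroup (M i)] [∀ i, Module A (M i)] [∀ i, TopologicalSpace (M i)] :
    ObjectProperty (TopModuleCat.{w} A) := fun U =>
  ∃ κ : Fin s → Type w, Nonempty (U ≃L[A] (∀ i, κ i → M i))

/-- A topological module is profinite if its underlying topological space is. -/
def IsProfinite {A : Type u} [Ring A] [TopologicalSpace A] (X : TopModuleCat.{w} A) : Prop :=
  CompactSpace X ∧ T2Space X ∧ TotallyDisconnectedSpace X

/-- The profinite modules that are projective in the category of profinite modules: continuous
homomorphisms out of them lift along surjections of profinite modules. -/
def IsProfiniteProjective (A : Type u) [Ring A] [TopologicalSpace A] :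
    ObjectProperty (TopModuleCat.{w} A) := fun P =>
  IsProfinite P ∧ ∀ X Y : TopModuleCat.{w} A, IsProfinite X → IsProfinite Y →
    ∀ (p : X ⟶ Y) (f : P ⟶ Y), Function.Surjective p.hom → ∃ g : P ⟶ X, g ≫ p = f

end Categories

end ProfMod

set_option linter.unusedSectionVars false

/-! Write `B` for the opposite of `E`. The idempotents of `M` onto its factors sum to 1, and for `U
= ∏ M_i^{κ_i}` the space `Hom(M, U)` is a product of left ideals `B e_i`. `TopDualBasis` records
this by basis vectors and continuous coordinates.

Fully faithful: `R` is central in `RG`, so each `M_i` is finite over its endomorphism ring, and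
every `u` in `U` is a sum `∑ f_j (b_j)` for fixed `b_j` in `M` (`exists_sum_hom_apply_eq`). A
continuous `φ` must then come from `f m ↦ φ f m`. This is well defined because the dual basis
expansion of `f` turns `φ f m` into a series depending only on `f m` (`exists_hom_apply_eq`).

Projective: if a profinite module maps onto one with a dual basis, a minimal closed submodule still
mapping onto it is the image of a section (`exists_section`). Lifting follows by a pullback.

Essentially surjective: a profinite `P` has a cover `g` by a product `Q` of the `B e_i`, one factor
for each member of an independent family of open maximal submodules. A Nakayama argument makes `g`
surjective. If `g` splits, locality of `e_i B e_i` makes it injective (`exists_projective_cover`),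
and projectivity of `P` supplies the splitting. Locality comes from compactness of `End(M_i)`: an
idempotent in a suitable compact semigroup shows that `f` or `1 - f` is a unit. -/

namespace ProfMod

/-! ### Open submodules of profinite modules -/

section Profinite

variable {B : Type*} [Ring B] [TopologicalSpace B] [IsTopologicalRing B] [CompactSpace B]
variable {P : Type*} [AddCommGroup P] [Module B P] [TopologicalSpace P] [IsTopologicalAddGroup P]
  [ContinuousSMul B P]

/-- In a profinite module over a compact ring, the open submodules form a neighbourhood basis
of zero. -/
theorem exists_open_submodule_subset [CompactSpace P] [T2Space P] [TotallyDisconnectedSpace P]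
    {W : Set P} (hW : IsOpen W) (h0 : (0 : P) ∈ W) :
    ∃ V : Submodule B P, IsOpen (V : Set P) ∧ (V : Set P) ⊆ W := by
  obtain ⟨C, hC, h0C, hCW⟩ := compact_exists_isClopen_in_isOpen hW h0
  obtain ⟨H, hH⟩ := IsTopologicalAddGroup.exist_openAddSubgroup_sub_clopen_nhds_of_zero hC h0C
  -- The largest submodule inside `H`. Its complement is the projection of a closed set along the
  -- compact factor `B`, hence closed.
  let V : Submodule B P :=
    { carrier := {x | ∀ b : B, b • x ∈ H}
      add_mem' := fun hx hy b => by rw [smul_add]; exact H.add_mem (hx b) (hy b)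
      zero_mem' := fun b => by rw [smul_zero]; exact H.zero_mem
      smul_mem' := fun c x hx b => by rw [← mul_smul]; exact hx _ }
  refine ⟨V, ?_, fun x hx => hCW (hH (by simpa using hx 1))⟩
  have hcl : IsClosed {q : B × P | q.1 • q.2 ∈ (H : Set P)ᶜ} :=
    H.isOpen.isClosed_compl.preimage continuous_smul
  have hV : (V : Set P)ᶜ = Prod.snd '' {q : B × P | q.1 • q.2 ∈ (H : Set P)ᶜ} := by
    ext x
    constructor
    · intro hx
      obtain ⟨b, hb⟩ := not_forall.1 hx
      exact ⟨(b, x), hb, rfl⟩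
    · rintro ⟨⟨b, x⟩, hb, rfl⟩ hx
      exact hb (hx b)
  rw [← isClosed_compl_iff, hV]
  exact isClosedMap_snd_of_compactSpace _ hcl

/-- A proper closed submodule of a profinite module is contained in an open maximal one. -/
theorem exists_isCoatom_isOpen [CompactSpace P] [T2Space P] [TotallyDisconnectedSpace P]
    {C : Submodule B P} (hC : IsClosed (C : Set P)) (hne : C ≠ ⊤) :
    ∃ N : Submodule B P, IsCoatom N ∧ IsOpen (N : Set P) ∧ C ≤ N := by
  -- After enlarging `C` by a small open submodule that keeps `p` outside, the quotient is finite
  -- and so has a maximal submodule.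
  obtain ⟨p, hp⟩ : ∃ p, p ∉ C := by
    by_contra! h
    exact hne (Submodule.eq_top_iff'.2 h)
  obtain ⟨V, hVo, hV⟩ := exists_open_submodule_subset (B := B)
    (W := (fun x => p - x) ⁻¹' (C : Set P)ᶜ) (hC.isOpen_compl.preimage (by fun_prop))
    (by simpa using hp)
  set W := C ⊔ V with hW
  have hWo : IsOpen (W : Set P) :=
    AddSubgroup.isOpen_mono (H₁ := V.toAddSubgroup) (H₂ := W.toAddSubgroup)
      (fun x hx => (le_sup_right : V ≤ W) hx) hVo
  have hpW : p ∉ W := by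
    intro h
    obtain ⟨c, hc, v, hv, rfl⟩ := Submodule.mem_sup.1 h
    exact hV hv (by simpa using hc)
  have hfin : Finite (P ⧸ W) := AddSubgroup.quotient_finite_of_isOpen W.toAddSubgroup hWo
  have : Finite (Submodule B (P ⧸ W)) :=
    Finite.of_injective (fun S => (S : Set (P ⧸ W))) SetLike.coe_injective
  have hnt : (⊥ : Submodule B (P ⧸ W)) ≠ ⊤ := by
    intro h
    apply hpW
    have : W.mkQ p ∈ (⊥ : Submodule B (P ⧸ W)) := by rw [h]; trivial
    simpa using this
  obtain ⟨K, hK, -⟩ := (eq_top_or_exists_le_coatom (⊥ : Submodule B (P ⧸ W))).resolve_left hnt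
  have hWK : W ≤ K.comap W.mkQ := fun x hx => by
    have : W.mkQ x = 0 := by simpa using hx
    simp [Submodule.mem_comap, this]
  refine ⟨K.comap W.mkQ, ?_, ?_, le_sup_left.trans hWK⟩
  · refine ⟨fun h => hK.1 ?_, fun N hN => ?_⟩
    · rw [← Submodule.map_comap_eq_of_surjective W.mkQ_surjective K, h, Submodule.map_top,
        LinearMap.range_eq_top.2 W.mkQ_surjective]
    · have h1 : K < N.map W.mkQ := by
        have hNW : (N.map W.mkQ).comap W.mkQ = N := by
          rw [Submodule.comap_map_mkQ, sup_eq_right]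
          exact hWK.trans hN.le
        refine lt_of_le_of_ne ?_ ?_
        · rw [← Submodule.map_comap_eq_of_surjective W.mkQ_surjective K]
          exact Submodule.map_mono hN.le
        · rintro rfl
          exact hN.ne hNW
      have h2 := hK.2 _ h1
      have hNW : (N.map W.mkQ).comap W.mkQ = N := by
        rw [Submodule.comap_map_mkQ, sup_eq_right]
        exact hWK.trans hN.le
      rw [← hNW, h2, Submodule.comap_top]
  · exact AddSubgroup.isOpen_mono (H₁ := W.toAddSubgroup)
      (H₂ := (K.comap W.mkQ).toAddSubgroup) (fun x hx => hWK hx) hWo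

end Profinite

/-! ### Topological dual bases and projectivity -/

/-- A topological dual basis of a module `P` with respect to a family `e` of elements of `B`:
it identifies `P` with the product of the left ideals `B • e x`. -/
structure TopDualBasis (B : Type*) [Ring B] [TopologicalSpace B] (P : Type*) [AddCommGroup P]
    [Module B P] [TopologicalSpace P] {I : Type*} (e : I → B) where
  /-- The basis vectors. -/
  vec : I → P
  /-- The coordinate functions. -/
  coord : I → P →L[B] B
  coord_vec_self : ∀ x, coord x (vec x) = e x
  coord_vec_ne : ∀ x y, x ≠ y → coord x (vec y) = 0
  coord_mul : ∀ x p, coord x p * e x = coord x p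
  eq_zero : ∀ p, (∀ x, coord x p = 0) → p = 0

namespace TopDualBasis

variable {B : Type*} [Ring B] [TopologicalSpace B] [IsTopologicalRing B]
variable {P : Type*} [AddCommGroup P] [Module B P] [TopologicalSpace P] [IsTopologicalAddGroup P]
  [ContinuousSMul B P] {I : Type*} {e : I → B}

theorem mul_self (b : TopDualBasis B P e) (x : I) : e x * e x = e x := by
  have h := b.coord_mul x (b.vec x)
  rwa [b.coord_vec_self] at h

theorem smul_vec (b : TopDualBasis B P e) (x : I) : e x • b.vec x = b.vec x := by
  rw [← sub_eq_zero]
  refine b.eq_zero _ fun y => ?_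
  rw [map_sub, map_smul]
  by_cases h : y = x
  · subst h
    rw [b.coord_vec_self, smul_eq_mul, b.mul_self, sub_self]
  · rw [b.coord_vec_ne _ _ h, smul_zero, sub_zero]

open Classical in
theorem coord_sum (b : TopDualBasis B P e) (F : Finset I) (a : I → B) (y : I) :
    b.coord y (∑ x ∈ F, a x • b.vec x) = if y ∈ F then a y * e y else 0 := by
  rw [map_sum]
  split_ifs with h
  · rw [Finset.sum_eq_single_of_mem y h, map_smul, b.coord_vec_self, smul_eq_mul]
    intro x _ hx
    rw [map_smul, b.coord_vec_ne _ _ hx.symm, smul_zero]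
  · refine Finset.sum_eq_zero fun x hx => ?_
    rw [map_smul, b.coord_vec_ne _ _ (by rintro rfl; exact h hx), smul_zero]

/-- The approximations of an element by finite sums agree in the given coordinates. -/
theorem coord_sub_sum (b : TopDualBasis B P e) (F : Finset I) (p : P) {y : I} (hy : y ∈ F) :
    b.coord y (p - ∑ x ∈ F, b.coord x p • b.vec x) = 0 := by
  rw [map_sub, b.coord_sum, if_pos hy, b.coord_mul, sub_self]

/-- By compactness, the zero sets of the coordinates, which meet only in 0, already meet inside `W`
for finitely many of them. -/
theorem exists_finset (b : TopDualBasis B P e) [T2Space B] [CompactSpace P] {W : Set P} (hW : IsOpen W)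
    (h0 : (0 : P) ∈ W) : ∃ F : Finset I, ∀ p, (∀ x ∈ F, b.coord x p = 0) → p ∈ W := by
  obtain ⟨F, hF⟩ := hW.isClosed_compl.isCompact.elim_finite_subfamily_closed
    (fun x => {p | b.coord x p = 0})
    (fun x => isClosed_eq (b.coord x).continuous continuous_const) (by
      refine Set.eq_empty_of_forall_notMem fun p hp => hp.1 ?_
      rw [b.eq_zero p fun x => Set.mem_iInter.1 hp.2 x]
      exact h0)
  refine ⟨F, fun p hp => ?_⟩
  by_contra h
  exact (Set.eq_empty_iff_forall_notMem.1 hF p) ⟨h, Set.mem_iInter₂.2 hp⟩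

/-- Prescribing coordinates. -/
theorem exists_coord_eq (b : TopDualBasis B P e) [T2Space B] [CompactSpace P] (a : I → B) :
    ∃ p, ∀ x, b.coord x p = a x * e x := by
  obtain ⟨p, hp⟩ := CompactSpace.iInter_nonempty (X := P)
    (t := fun x => {p | b.coord x p = a x * e x})
    (fun x => isClosed_eq (b.coord x).continuous continuous_const) (fun F => by
      refine ⟨∑ x ∈ F, a x • b.vec x, Set.mem_iInter₂.2 fun x hx => ?_⟩
      classical
      rw [Set.mem_ofPred_eq, b.coord_sum, if_pos hx])
  exact ⟨p, fun x => Set.mem_iInter.1 hp x⟩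

/-- A minimal closed submodule mapping onto a module with a topological dual basis maps
injectively. -/
theorem injective_of_minimal (b : TopDualBasis B P e) [CompactSpace B] [T2Space B] [CompactSpace P] [T2Space P]
    {Γ : Type*} [AddCommGroup Γ] [Module B Γ] [TopologicalSpace Γ] [IsTopologicalAddGroup Γ]
    [ContinuousSMul B Γ] [CompactSpace Γ] [T2Space Γ] [TotallyDisconnectedSpace Γ]
    (π : Γ →L[B] P) {D : Submodule B Γ} (hDc : IsClosed (D : Set Γ))
    (hD : ∀ p, ∃ γ ∈ D, π γ = p)
    (hmin : ∀ D' : Submodule B Γ, D' ≤ D → IsClosed (D' : Set Γ) → (∀ p, ∃ γ ∈ D', π γ = p) →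
      D' = D) {k : Γ} (hkD : k ∈ D) (hk : π k = 0) : k = 0 := by
  by_contra hk0
  obtain ⟨V, hVo, hV⟩ := exists_open_submodule_subset (B := B) (W := {k}ᶜ)
    isOpen_compl_singleton (by simpa using fun h => hk0 h.symm)
  have hVc : IsClosed (V : Set Γ) := AddSubgroup.isClosed_of_isOpen V.toAddSubgroup hVo
  -- the image of `V ⊓ D` contains a neighbourhood of zero
  have hopen : ∃ W : Set P, IsOpen W ∧ (0 : P) ∈ W ∧ ∀ p ∈ W, ∃ γ ∈ V ⊓ D, π γ = p := by
    let H : AddSubgroup P := (Submodule.map π.toLinearMap (V ⊓ D)).toAddSubgroup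
    have hHc : IsClosed (H : Set P) :=
      ((hVc.inter hDc).isCompact.image π.continuous).isClosed
    have hfin : Finite (Γ ⧸ V) := AddSubgroup.quotient_finite_of_isOpen V.toAddSubgroup hVo
    choose s hsD hs using hD
    -- `V ⊓ D` has finite index in `D`, which maps onto `P`; its image is closed of finite index,
    -- hence open.
    have hfi : H.FiniteIndex := by
      have : Finite (P ⧸ H) := by
        refine Finite.of_injective (β := Γ ⧸ V)
          (fun q => V.mkQ (s (Quotient.out q))) fun q q' hqq => ?_
        rw [← Quotient.out_eq q, ← Quotient.out_eq q']
        refine QuotientAddGroup.eq.2 ?_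
        have h1 : s q'.out - s q.out ∈ V := (Submodule.Quotient.eq V).1 hqq.symm
        refine ⟨s q'.out - s q.out, ⟨h1, D.sub_mem (hsD _) (hsD _)⟩, ?_⟩
        change π _ = _
        rw [map_sub, hs, hs]
        abel
      exact AddSubgroup.finiteIndex_of_finite_quotient
    refine ⟨H, H.isOpen_of_isClosed_of_finiteIndex hHc, H.zero_mem, fun p hp => ?_⟩
    obtain ⟨γ, hγ, rfl⟩ := hp
    exact ⟨γ, hγ, rfl⟩
  obtain ⟨W, hWo, h0W, hW⟩ := hopen
  obtain ⟨F, hF⟩ := b.exists_finset hWo h0W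
  choose g hgD hg using fun x => hD (b.vec x)
  let s : P →L[B] Γ := ∑ x ∈ F, (b.coord x).smulRight (g x)
  have hs : ∀ p, s p = ∑ x ∈ F, b.coord x p • g x := fun p => by
    simp [s]
  have hπs : ∀ p, π (s p) = ∑ x ∈ F, b.coord x p • b.vec x := fun p => by
    rw [hs, map_sum]
    exact Finset.sum_congr rfl fun x _ => by rw [map_smul, hg]
  have hsD : ∀ p, s p ∈ D := fun p => by
    rw [hs]
    exact D.sum_mem fun x _ => D.smul_mem _ (hgD x)
  -- `s` lifts the coordinates in `F`, and `T` lies in `V` and covers the rest. So `range s ⊔ T`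
  -- still maps onto `P` and equals `D`. Writing `k = s p + v`, the `F`-coordinates of `π k = 0`
  -- force `s p = 0`, so `k ∈ V`, which is excluded.
  let T : Submodule B Γ := V ⊓ D ⊓ ⨅ x ∈ F, LinearMap.ker ((b.coord x).comp π).toLinearMap
  have hT : ∀ γ, γ ∈ T ↔ (γ ∈ V ∧ γ ∈ D) ∧ ∀ x ∈ F, b.coord x (π γ) = 0 := fun γ => by
    simp [T, Submodule.mem_inf, Submodule.mem_iInf]
  have hTc : IsClosed (T : Set Γ) := by
    have : (T : Set Γ) = ((V : Set Γ) ∩ D) ∩ ⋂ x ∈ F, {γ | b.coord x (π γ) = 0} := by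
      ext γ
      simp [hT]
    rw [this]
    exact (hVc.inter hDc).inter (isClosed_biInter fun x _ =>
      isClosed_eq ((b.coord x).continuous.comp π.continuous) continuous_const)
  have hD' : LinearMap.range s.toLinearMap ⊔ T = D := by
    refine hmin _ (sup_le ?_ ?_) ?_ ?_
    · rintro _ ⟨p, rfl⟩
      exact hsD p
    · exact fun γ hγ => ((hT γ).1 hγ).1.2
    · have h : ((LinearMap.range s.toLinearMap ⊔ T : Submodule B Γ) : Set Γ) =
          (fun q : Γ × Γ => q.1 + q.2) '' (Set.range s ×ˢ (T : Set Γ)) := by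
        ext γ
        simp only [SetLike.mem_coe, Submodule.mem_sup, Set.mem_image, Set.mem_prod, Prod.exists]
        constructor
        · rintro ⟨y, ⟨p, rfl⟩, z, hz, rfl⟩
          exact ⟨_, z, ⟨⟨p, rfl⟩, hz⟩, rfl⟩
        · rintro ⟨y, z, ⟨⟨p, rfl⟩, hz⟩, rfl⟩
          exact ⟨_, ⟨p, rfl⟩, z, hz, rfl⟩
      rw [h]
      exact (((isCompact_range s.continuous).prod hTc.isCompact).image continuous_add).isClosed
    · intro p
      obtain ⟨γ, hγ, hγp⟩ := hW (p - ∑ x ∈ F, b.coord x p • b.vec x)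
        (hF _ fun x hx => b.coord_sub_sum F p hx)
      refine ⟨s p + γ, Submodule.add_mem_sup ⟨p, rfl⟩ ((hT γ).2 ⟨hγ, fun x hx => ?_⟩), ?_⟩
      · rw [hγp]
        exact b.coord_sub_sum F p hx
      · rw [map_add, hπs, hγp]
        abel
  rw [← hD'] at hkD
  obtain ⟨_, ⟨p, rfl⟩, v, hv, rfl⟩ := Submodule.mem_sup.1 hkD
  rw [hT] at hv
  change π (s p + v) = 0 at hk
  have hsp : s p = 0 := by
    rw [hs]
    refine Finset.sum_eq_zero fun x hx => ?_
    have h := congrArg (b.coord x) hk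
    classical
    rw [map_add, map_add, hv.2 x hx, add_zero, hπs, b.coord_sum, if_pos hx, b.coord_mul,
      map_zero] at h
    rw [h, zero_smul]
  refine hV hv.1.1 ?_
  change v = s p + v
  rw [hsp, zero_add]

/-- Every continuous surjection from a profinite module onto a module with a topological dual
basis splits. -/
theorem exists_section (b : TopDualBasis B P e) [CompactSpace B] [T2Space B] [CompactSpace P] [T2Space P]
    {Γ : Type*} [AddCommGroup Γ] [Module B Γ] [TopologicalSpace Γ] [IsTopologicalAddGroup Γ]
    [ContinuousSMul B Γ] [CompactSpace Γ] [T2Space Γ] [TotallyDisconnectedSpace Γ]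
    (π : Γ →L[B] P) {D₀ : Submodule B Γ} (hD₀c : IsClosed (D₀ : Set Γ))
    (hD₀ : ∀ p, ∃ γ ∈ D₀, π γ = p) :
    ∃ s : P →L[B] Γ, (∀ p, s p ∈ D₀) ∧ ∀ p, π (s p) = p := by
  let S : Set (Submodule B Γ) := {D | IsClosed (D : Set Γ) ∧ ∀ p, ∃ γ ∈ D, π γ = p}
  obtain ⟨D, hDD₀, hDmin⟩ : ∃ D, D ≤ D₀ ∧ Minimal (· ∈ S) D := by
    refine zorn_le_nonempty₀ (α := (Submodule B Γ)ᵒᵈ) S (fun c hcS hc D hD => ?_) D₀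
      ⟨hD₀c, hD₀⟩
    let c' : Set (Submodule B Γ) := c
    refine ⟨(sInf c' : Submodule B Γ), ⟨?_, fun p => ?_⟩, fun z hz => sInf_le (α := Submodule B Γ) hz⟩
    · rw [Submodule.coe_sInf]
      exact isClosed_biInter fun D hD => (hcS hD).1
    -- The fibre over `p` meets the members of the chain in nested nonempty compact sets.
    · have : Nonempty c' := ⟨⟨D, hD⟩⟩
      obtain ⟨γ, hγ⟩ := IsCompact.nonempty_iInter_of_directed_nonempty_isCompact_isClosed
        (fun D : c' => (D.1 : Set Γ) ∩ π ⁻¹' {p})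
        (by
          intro D₁ D₂
          rcases hc.total D₁.2 D₂.2 with h | h
          · exact ⟨D₂, fun x hx => ⟨h hx.1, hx.2⟩, fun x hx => hx⟩
          · exact ⟨D₁, fun x hx => hx, fun x hx => ⟨h hx.1, hx.2⟩⟩)
        (fun D => by
          obtain ⟨γ, h1, h2⟩ := (hcS D.2).2 p
          exact ⟨γ, h1, h2⟩)
        (fun D => ((hcS D.2).1.inter (isClosed_singleton.preimage π.continuous)).isCompact)
        (fun D => (hcS D.2).1.inter (isClosed_singleton.preimage π.continuous))
      rw [Set.mem_iInter] at hγ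
      exact ⟨γ, Submodule.mem_sInf.2 fun D hD => (hγ ⟨D, hD⟩).1, (hγ ⟨D, hD⟩).2⟩
  have hDS := hDmin.prop
  have hinj : Function.Injective (fun γ : D => π γ) := by
    intro γ γ' h
    rw [← sub_eq_zero, ← Submodule.coe_eq_zero]
    refine b.injective_of_minimal π hDS.1 hDS.2 (fun D' hD' hc hs =>
      le_antisymm hD' (hDmin.le_of_le ⟨hc, hs⟩ hD')) (γ - γ').2 ?_
    change π γ = π γ' at h
    rw [Submodule.coe_sub, map_sub, h, sub_self]
  have hsurj : Function.Surjective (fun γ : D => π γ) := fun p => by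
    obtain ⟨γ, h, hp⟩ := hDS.2 p
    exact ⟨⟨γ, h⟩, hp⟩
  let f : D ≃ₗ[B] P := LinearEquiv.ofBijective (π.toLinearMap.comp D.subtype) ⟨hinj, hsurj⟩
  have hf : ∀ γ, f γ = π γ := fun _ => rfl
  have : CompactSpace D := isCompact_iff_compactSpace.1 hDS.1.isCompact
  have hcont : Continuous f := π.continuous.comp continuous_subtype_val
  have hcl : Topology.IsClosedEmbedding f := hcont.isClosedEmbedding f.injective
  have hcs : Continuous f.symm :=
    (Homeomorph.continuous (Equiv.toHomeomorphOfIsInducing f.toEquiv hcl.isInducing).symm)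
  let f' : P →L[B] D := ⟨f.symm.toLinearMap, hcs⟩
  exact ⟨D.subtypeL.comp f', fun p => hDD₀ (f.symm p).2, fun p => f.apply_symm_apply p⟩

/-- Modules with a topological dual basis are projective among profinite modules. -/
theorem exists_lift (b : TopDualBasis B P e) [CompactSpace B] [T2Space B] [CompactSpace P] [T2Space P]
    [TotallyDisconnectedSpace P]
    {X Y : Type*} [AddCommGroup X] [Module B X] [TopologicalSpace X] [IsTopologicalAddGroup X]
    [ContinuousSMul B X] [CompactSpace X] [T2Space X] [TotallyDisconnectedSpace X]
    [AddCommGroup Y] [Module B Y] [TopologicalSpace Y] [T2Space Y]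
    (π : X →L[B] Y) (hπ : Function.Surjective π) (f : P →L[B] Y) :
    ∃ g : P →L[B] X, ∀ p, π (g p) = f p := by
  -- The pullback of `π` along `f`; a section of its projection to `P` is a lift.
  let D : Submodule B (P × X) := LinearMap.eqLocus
    (f.toLinearMap.comp (LinearMap.fst B P X)) (π.toLinearMap.comp (LinearMap.snd B P X))
  have hD : ∀ q, q ∈ D ↔ f q.1 = π q.2 := fun q => Iff.rfl
  obtain ⟨s, hsD, hs⟩ := b.exists_section (ContinuousLinearMap.fst B P X) (D₀ := D)
    (isClosed_eq (f.continuous.comp continuous_fst) (π.continuous.comp continuous_snd))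
    (fun p => by
      obtain ⟨x, hx⟩ := hπ (f p)
      exact ⟨(p, x), hx.symm, rfl⟩)
  refine ⟨(ContinuousLinearMap.snd B P X).comp s, fun p => ?_⟩
  have h := (hD _).1 (hsD p)
  have h1 : (s p).1 = p := hs p
  rw [h1] at h
  exact h.symm

end TopDualBasis

/-! ### Projective covers of profinite modules -/

section ProjectiveStructure

variable {B : Type*} [Ring B] [TopologicalSpace B] [IsTopologicalRing B] [CompactSpace B]
variable {P : Type*} [AddCommGroup P] [Module B P] [TopologicalSpace P] [IsTopologicalAddGroup P]

theorem exists_smul_sub_mem {B P : Type*} [Ring B] [AddCommGroup P] [Module B P]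
    {N : Submodule B P} (hN : IsCoatom N) {p : P} (hp : p ∉ N) (z : P) :
    ∃ a : B, a • p - z ∈ N := by
  have h : N ⊔ Submodule.span B {p} = ⊤ := by
    refine hN.2 _ (lt_of_le_of_ne le_sup_left fun h => hp ?_)
    rw [h]
    exact (le_sup_right : _ ≤ N ⊔ Submodule.span B {p}) (Submodule.mem_span_singleton_self p)
  obtain ⟨n, hn, q, hq, hz⟩ := Submodule.mem_sup.1 (h ▸ Submodule.mem_top : z ∈ N ⊔ _)
  obtain ⟨a, rfl⟩ := Submodule.mem_span_singleton.1 hq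
  exact ⟨a, by rw [← hz]; simpa using hn⟩

/-- There is a set `X` of open maximal submodules `N` of `P` such that `P → ∏ N ∈ X, P ⧸ N` is
surjective and its kernel is contained in all open maximal submodules. -/
theorem exists_independent_maximal_submodules [CompactSpace P] :
    ∃ X : Set (Submodule B P), (∀ N ∈ X, IsCoatom N ∧ IsOpen (N : Set P)) ∧
      (∀ y : Submodule B P → P, ∃ p, ∀ N ∈ X, p - y N ∈ N) ∧
      ∀ N' : Submodule B P, IsCoatom N' → IsOpen (N' : Set P) → ∀ p, (∀ N ∈ X, p ∈ N) → p ∈ N' := by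
  -- Asking for simultaneous congruences only on finite subfamilies makes `S` stable under unions of
  -- chains; compactness then gives them for all of `X`.
  let S : Set (Set (Submodule B P)) := {X | (∀ N ∈ X, IsCoatom N ∧ IsOpen (N : Set P)) ∧
    ∀ F : Finset (Submodule B P), (F : Set (Submodule B P)) ⊆ X →
      ∀ y : Submodule B P → P, ∃ p, ∀ N ∈ F, p - y N ∈ N}
  obtain ⟨X, hX⟩ : ∃ X, Maximal (· ∈ S) X := by
    refine zorn_subset S fun c hcS hc => ?_
    rcases c.eq_empty_or_nonempty with rfl | hne
    · refine ⟨∅, ⟨by simp, fun F hF y => ⟨0, fun N hN => (hF hN).elim⟩⟩, by simp⟩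
    refine ⟨⋃₀ c, ⟨?_, fun F hF y => ?_⟩, fun s hs => Set.subset_sUnion_of_mem hs⟩
    · rintro N ⟨X, hX, hN⟩
      exact (hcS hX).1 N hN
    · obtain ⟨X, hX, hFX⟩ := hc.directedOn.exists_mem_subset_of_finite_of_subset_sUnion hne
        F.finite_toSet hF
      exact (hcS hX).2 F hFX y
  have hXS := hX.prop
  have hind : ∀ y : Submodule B P → P, ∃ p, ∀ N ∈ X, p - y N ∈ N := by
    intro y
    obtain ⟨p, hp⟩ := CompactSpace.iInter_nonempty (X := P)
      (t := fun N : X => (fun p => p - y N.1) ⁻¹' (N.1 : Set P))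
      (fun N => (AddSubgroup.isClosed_of_isOpen N.1.toAddSubgroup (hXS.1 N.1 N.2).2).preimage
        (by fun_prop))
      (fun F => by
        classical
        obtain ⟨p, hp⟩ := hXS.2 (F.image Subtype.val) (by simp) y
        exact ⟨p, Set.mem_iInter₂.2 fun N hN => hp _ (Finset.mem_image_of_mem _ hN)⟩)
    exact ⟨p, fun N hN => Set.mem_iInter.1 hp ⟨N, hN⟩⟩
  refine ⟨X, hXS.1, hind, fun N' hN' hN'o p hp => ?_⟩
  by_contra hpN'
  refine hpN' (hp N' (hX.le_of_ge (y := insert N' X) ⟨?_, fun F hF y => ?_⟩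
    (Set.subset_insert _ _) (Set.mem_insert _ _)))
  · rintro N (rfl | hN)
    · exact ⟨hN', hN'o⟩
    · exact hXS.1 N hN
  -- A multiple of `p` corrects the class modulo `N'` without disturbing those modulo `N ∈ X`.
  · obtain ⟨q, hq⟩ := hind y
    obtain ⟨a, ha⟩ := exists_smul_sub_mem hN' hpN' (y N' - q)
    refine ⟨q + a • p, fun N hN => ?_⟩
    rcases hF hN with rfl | hN
    · convert! ha using 1
      abel
    · rw [add_sub_right_comm]
      exact N.add_mem (hq N hN) (N.smul_mem _ (hp N hN))

/-- If `1` is a sum of idempotents `e i` of `B` with local rings `e i * B * e i`, then for every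
profinite module `P` there are index sets `κ i` such that every profinite `Q` with a topological
dual basis with `κ i` vectors for `e i` is a projective cover of `P`. -/
theorem exists_projective_cover {P : Type w} [AddCommGroup P] [Module B P] [TopologicalSpace P]
    [IsTopologicalAddGroup P] [T2Space B] [ContinuousSMul B P] [CompactSpace P] [T2Space P]
    [TotallyDisconnectedSpace P] {ι : Type*} [Fintype ι] (e : ι → B) (he : ∀ i, e i * e i = e i)
    (hsum : ∑ i, e i = 1)
    (hloc : ∀ i r, ∃ v, v * (e i * r * e i) = e i ∨ v * (e i - e i * r * e i) = e i) :
    ∃ κ : ι → Type w, ∀ (Q : Type w) [AddCommGroup Q] [Module B Q] [TopologicalSpace Q]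
      [IsTopologicalAddGroup Q] [ContinuousSMul B Q] [CompactSpace Q] [T2Space Q]
      [TotallyDisconnectedSpace Q], TopDualBasis B Q (fun x : Σ i, κ i => e x.1) →
      ∃ g : Q →L[B] P, Function.Surjective g ∧
        ∀ t : P →L[B] Q, (∀ p, g (t p) = p) → Function.Injective g := by
  obtain ⟨X, hX, hind, hmax⟩ := exists_independent_maximal_submodules (B := B) (P := P)
  -- Since the `e i` sum to 1, some `e i • P` is not contained in `N`.
  have hp : ∀ N : X, ∃ (i : ι) (p : P), e i • p = p ∧ p ∉ N.1 := by
    intro N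
    by_contra! h
    refine (hX N.1 N.2).1.1 (Submodule.eq_top_iff'.2 fun p => ?_)
    rw [← one_smul B p, ← hsum, Finset.sum_smul]
    exact N.1.sum_mem fun i _ => h i _ (by rw [← mul_smul, he])
  choose i p₀ hp₀ hpN₀ using hp
  let κ : ι → Type w := fun j => {N : X // i N = j}
  let N : (Σ j, κ j) → Submodule B P := fun x => x.2.1.1
  let p : (Σ j, κ j) → P := fun x => p₀ x.2.1
  have hpN : ∀ x, p x ∉ N x := fun x => hpN₀ _
  have hpe : ∀ x, e x.1 • p x = p x := by
    rintro ⟨_, N, rfl⟩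
    exact hp₀ N
  have hNc : ∀ x, IsCoatom (N x) := fun x => (hX _ x.2.1.2).1
  have hNo : ∀ x, IsOpen (N x : Set P) := fun x => (hX _ x.2.1.2).2
  have hN : ∀ y : (Σ j, κ j) → P, ∃ q, ∀ x, q - y x ∈ N x := by
    intro y
    classical
    obtain ⟨q, hq⟩ := hind fun M => if h : M ∈ X then y ⟨i ⟨M, h⟩, ⟨⟨M, h⟩, rfl⟩⟩ else 0
    refine ⟨q, ?_⟩
    rintro ⟨_, ⟨M, hM⟩, rfl⟩
    have := hq M hM
    rwa [dif_pos hM] at this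
  have hNmax : ∀ N' : Submodule B P, IsCoatom N' → IsOpen (N' : Set P) →
      ∀ q, (∀ x, q ∈ N x) → q ∈ N' := fun N' h h' q hq =>
    hmax N' h h' q fun M hM => hq ⟨_, ⟨⟨M, hM⟩, rfl⟩⟩
  refine ⟨κ, fun Q _ _ _ _ _ _ _ _ b => ?_⟩
  have hcl : ∀ x, IsClosed {q : Q × P | q.2 - b.coord x q.1 • p x ∈ N x} := fun x =>
    (AddSubgroup.isClosed_of_isOpen (N x).toAddSubgroup (hNo x)).preimage
      (continuous_snd.sub (((b.coord x).continuous.comp continuous_fst).smul continuous_const))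
  -- A section of `D` over `Q` lifts the map `Q → ∏ P ⧸ N x` given by the coordinates to a map into
  -- `P`.
  let D : Submodule B (Q × P) :=
    { carrier := {q | ∀ x, q.2 - b.coord x q.1 • p x ∈ N x}
      add_mem' := fun {q q'} hq hq' x => by
        have := (N x).add_mem (hq x) (hq' x)
        rw [Prod.snd_add, Prod.fst_add, map_add, add_smul]
        convert! this using 1
        abel
      zero_mem' := fun x => by simp
      smul_mem' := fun a q hq x => by
        have := (N x).smul_mem a (hq x)
        rwa [smul_sub, ← mul_smul, ← smul_eq_mul, ← map_smul] at this }
  have hDc : IsClosed (D : Set (Q × P)) := by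
    have : (D : Set (Q × P)) = ⋂ x, {q : Q × P | q.2 - b.coord x q.1 • p x ∈ N x} := by
      ext q
      simp [D]
    rw [this]
    exact isClosed_iInter hcl
  obtain ⟨s, hsD, hs⟩ := b.exists_section (ContinuousLinearMap.fst B Q P) hDc (fun f => by
    obtain ⟨q, hq⟩ := hN fun x => b.coord x f • p x
    exact ⟨(f, q), hq, rfl⟩)
  let g : Q →L[B] P := (ContinuousLinearMap.snd B Q P).comp s
  have hg : ∀ f x, g f - b.coord x f • p x ∈ N x := fun f x => by
    have h := hsD f x
    have h1 : (s f).1 = f := hs f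
    rw [h1] at h
    exact h
  have hsurj : Function.Surjective g := by
    by_contra hns
    have hc : IsClosed ((LinearMap.range g.toLinearMap : Submodule B P) : Set P) := by
      have : ((LinearMap.range g.toLinearMap : Submodule B P) : Set P) = Set.range g := by
        ext; simp
      rw [this]
      exact (isCompact_range g.continuous).isClosed
    obtain ⟨N', hN', hN'o, hle⟩ := exists_isCoatom_isOpen hc
      (fun h => hns (LinearMap.range_eq_top.1 h))
    refine hN'.1 (Submodule.eq_top_iff'.2 fun q => ?_)
    -- Every `q` agrees with some `g f` modulo all `N x`, hence modulo `N'`, which contains the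
    -- range of `g`.
    choose a ha using fun x => exists_smul_sub_mem (hNc x) (hpN x) q
    obtain ⟨f, hf⟩ := b.exists_coord_eq a
    have h1 : q - g f ∈ N' := hNmax N' hN' hN'o _ fun x => by
      have h2 := (N x).add_mem (hg f x) (ha x)
      rw [hf, mul_smul, hpe] at h2
      rw [← neg_mem_iff]
      convert! h2 using 1
      abel
    have h2 : g f ∈ N' := hle ⟨f, rfl⟩
    simpa using N'.add_mem h1 h2
  refine ⟨g, hsurj, fun t ht => ?_⟩
  rw [injective_iff_map_eq_zero]
  intro k hk
  by_contra hk0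
  have hc : IsClosed ((LinearMap.range t.toLinearMap : Submodule B Q) : Set Q) := by
    have : ((LinearMap.range t.toLinearMap : Submodule B Q) : Set Q) = Set.range t := by
      ext; simp
    rw [this]
    exact (isCompact_range t.continuous).isClosed
  obtain ⟨W, hW, hWo, hle⟩ := exists_isCoatom_isOpen hc (fun h => hk0 (by
    obtain ⟨q, hq⟩ := LinearMap.range_eq_top.1 h k
    change t q = k at hq
    rw [← hq, ht] at hk
    rw [← hq, hk, map_zero]))
  have hker : ∀ f, g f = 0 → f ∈ W := by
    intro f hf
    obtain ⟨F, hF⟩ := b.exists_finset hWo W.zero_mem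
    have h1 := hF _ fun x hx => b.coord_sub_sum F f hx
    have h2 : ∑ x ∈ F, b.coord x f • b.vec x ∈ W := W.sum_mem fun x _ => by
      by_contra hx
      have hfN : b.coord x f • p x ∈ N x := by
        have := hg f x
        rwa [hf, zero_sub, neg_mem_iff] at this
      obtain ⟨a, ha⟩ := exists_smul_sub_mem hW hx (b.vec x)
      have hce : b.coord x f * e x.1 = b.coord x f := b.coord_mul x f
      have hev : e x.1 • b.vec x = b.vec x := b.smul_vec x
      have hr : e x.1 * (a * b.coord x f) * e x.1 = e x.1 * (a * b.coord x f) := by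
        rw [mul_assoc, mul_assoc, hce]
      -- Here `a * coord x f` sends `p x` into `N x` and fixes `vec x` modulo `W`. Locality of the
      -- corner ring gives `p x ∈ N x` or `vec x ∈ W`, each impossible.
      obtain ⟨v, hv | hv⟩ := hloc x.1 (a * b.coord x f)
      · refine hpN x ?_
        rw [← hpe x, ← hv, hr, mul_smul, mul_smul, mul_smul]
        exact (N x).smul_mem _ ((N x).smul_mem _ ((N x).smul_mem _ hfN))
      · have hvec : b.vec x ∈ W := by
          rw [← hev, ← hv, hr, mul_smul, sub_smul, hev, mul_smul, mul_smul]
          refine W.smul_mem _ ?_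
          have := W.smul_mem (e x.1) ha
          rw [smul_sub, hev] at this
          rw [← neg_mem_iff]
          convert! this using 1
          abel
        exact hx (W.smul_mem _ hvec)
    simpa using W.add_mem h1 h2
  refine hW.1 (Submodule.eq_top_iff'.2 fun f => ?_)
  have h1 : f - t (g f) ∈ W := hker _ (by rw [map_sub, ht, sub_self])
  have h2 : t (g f) ∈ W := hle ⟨g f, rfl⟩
  simpa using W.add_mem h1 h2

end ProjectiveStructure

/-! ### Topology of finitely generated modules -/

section FiniteModules

variable {A : Type*} [Ring A] [TopologicalSpace A] [IsTopologicalRing A] [CompactSpace A]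
variable {N : Type*} [AddCommGroup N] [Module A N] [TopologicalSpace N] [IsModuleTopology A N]
  [Module.Finite A N]

/-- Finitely generated modules over a noetherian compact Hausdorff ring are Hausdorff. -/
theorem t2Space_of_finite [T2Space A] [IsNoetherianRing A] : T2Space N := by
  have := IsModuleTopology.topologicalAddGroup A N
  obtain ⟨n, q, hq⟩ := Module.Finite.exists_fin' A N
  obtain ⟨m, f, hf⟩ := Module.Finite.exists_fin' A (LinearMap.ker q)
  -- By noetherianity the kernel is a continuous image of some `A ^ m`, hence compact.
  have hk : IsClosed ((LinearMap.ker q : Submodule A (Fin n → A)) : Set (Fin n → A)) := by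
    have h : ((LinearMap.ker q : Submodule A (Fin n → A)) : Set (Fin n → A)) =
        Set.range ((LinearMap.ker q).subtype ∘ₗ f) := by
      ext x
      constructor
      · intro hx
        obtain ⟨y, hy⟩ := hf ⟨x, hx⟩
        exact ⟨y, congrArg Subtype.val hy⟩
      · rintro ⟨y, rfl⟩
        exact (f y).2
    rw [h]
    exact (isCompact_range (IsModuleTopology.continuous_of_linearMap _)).isClosed
  have h0 : IsClosed ({0} : Set N) := by
    rw [← (IsModuleTopology.isQuotientMap_of_surjective hq).isClosed_preimage]
    convert! hk
  have := IsTopologicalAddGroup.t1Space N h0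
  infer_instance

/-- Finitely generated modules over a noetherian profinite ring are totally disconnected. -/
theorem totallyDisconnectedSpace_of_finite [T2Space A] [TotallyDisconnectedSpace A]
    [IsNoetherianRing A] : TotallyDisconnectedSpace N := by
  have := IsModuleTopology.topologicalAddGroup A N
  have := t2Space_of_finite (A := A) (N := N)
  obtain ⟨n, q, hq⟩ := Module.Finite.exists_fin' A N
  have hqo := IsModuleTopology.isOpenQuotientMap_of_surjective hq
  have : NonarchimedeanAddGroup N := ⟨fun U hU => by
    obtain ⟨V, hVU, hV, h0⟩ := mem_nhds_iff.1 hU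
    obtain ⟨C, hC, h0C, hCV⟩ := compact_exists_isClopen_in_isOpen
      (hV.preimage hqo.continuous) (x := 0) (by simpa using h0)
    obtain ⟨H, hH⟩ := IsTopologicalAddGroup.exist_openAddSubgroup_sub_clopen_nhds_of_zero hC h0C
    refine ⟨⟨H.toAddSubgroup.map q.toAddMonoidHom, hqo.isOpenMap _ H.isOpen⟩, ?_⟩
    rintro _ ⟨x, hx, rfl⟩
    exact hVU (hCV (hH hx))⟩
  infer_instance

end FiniteModules

/-- A linear map vanishing on the kernel of a surjective linear map factors through it. -/
theorem exists_linearMap_comp_eq {A L M U : Type*} [Ring A] [AddCommGroup L] [Module A L]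
    [AddCommGroup M] [Module A M] [AddCommGroup U] [Module A U] {q : L →ₗ[A] M}
    (hq : Function.Surjective q) (l : L →ₗ[A] U) (h : ∀ x, q x = 0 → l x = 0) :
    ∃ f : M →ₗ[A] U, ∀ x, f (q x) = l x := by
  refine ⟨(LinearMap.ker q).liftQ l h ∘ₗ (q.quotKerEquivOfSurjective hq).symm.toLinearMap,
    fun x => ?_⟩
  have hx : (q.quotKerEquivOfSurjective hq).symm (q x) = Submodule.Quotient.mk x := by
    rw [LinearEquiv.symm_apply_eq]
    rfl
  change (LinearMap.ker q).liftQ l h ((q.quotKerEquivOfSurjective hq).symm (q x)) = _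
  rw [hx]
  rfl

/-! ### Compactness of homomorphism spaces -/

section HomSpace

variable {A : Type*} [Ring A]
variable {M : Type*} [AddCommGroup M] [Module A M] [TopologicalSpace M]
variable {U : Type*} [AddCommGroup U] [Module A U] [TopologicalSpace U]

theorem continuous_hom_apply (m : M) : Continuous fun f : M →ₗ[A] U => f m := by
  refine continuous_def.2 fun V hV => ?_
  refine TopologicalSpace.isOpen_generateFrom_of_mem ⟨{m}, V, isCompact_singleton, hV, ?_⟩
  ext f
  simp

theorem continuous_hom_coe : Continuous fun (f : M →ₗ[A] U) (m : M) => f m :=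
  continuous_pi continuous_hom_apply

instance hom_t2Space [T2Space U] : T2Space (M →ₗ[A] U) :=
  T2Space.of_injective_continuous DFunLike.coe_injective continuous_hom_coe

instance hom_totallyDisconnectedSpace [TotallyDisconnectedSpace U] :
    TotallyDisconnectedSpace (M →ₗ[A] U) :=
  ⟨isTotallyDisconnected_of_image continuous_hom_coe.continuousOn DFunLike.coe_injective
    (isTotallyDisconnected_of_totallyDisconnectedSpace _)⟩

variable [TopologicalSpace A]

instance hom_isTopologicalAddGroup [IsModuleTopology A M] [IsTopologicalAddGroup U]
    [ContinuousSMul A U] : IsTopologicalAddGroup (M →ₗ[A] U) where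
  continuous_neg := by
    have hi := isInducing_toContinuousMap (A := A) (M := M) (U := U)
    rw [hi.continuous_iff]
    exact hi.continuous.neg

/-- Homomorphisms from a finitely generated module to a compact Hausdorff module form a compact
space. -/
theorem hom_compactSpace [IsTopologicalRing A] [IsModuleTopology A M] [Module.Finite A M]
    [IsTopologicalAddGroup U] [ContinuousSMul A U] [CompactSpace U] [T2Space U] :
    CompactSpace (M →ₗ[A] U) := by
  obtain ⟨n, q, hq⟩ := Module.Finite.exists_fin' A M
  have hqo := IsModuleTopology.isOpenQuotientMap_of_surjective hq
  -- The possible values on the generators: a closed subset of `U ^ n`, mapped continuously onto the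
  -- homomorphism space.
  let S : Set (Fin n → U) := {u | ∀ a : Fin n → A, q a = 0 → ∑ k, a k • u k = 0}
  have hS : IsClosed S := by
    have : S = ⋂ (a : Fin n → A) (_ : q a = 0), {u | ∑ k, a k • u k = 0} := by
      ext u
      simp [S]
    rw [this]
    exact isClosed_iInter fun a => isClosed_iInter fun _ =>
      isClosed_eq (by fun_prop) continuous_const
  have : CompactSpace S := isCompact_iff_compactSpace.1 hS.isCompact
  let lin : S → ((Fin n → A) →ₗ[A] U) := fun u => Fintype.linearCombination A u.1
  have hlin : ∀ u a, lin u a = ∑ k, a k • u.1 k := fun u a =>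
    Fintype.linearCombination_apply _ _ _
  choose Φ hΦ' using fun u : S => exists_linearMap_comp_eq hq (lin u) fun a ha => by
    rw [hlin]
    exact u.2 a ha
  have hΦ : ∀ u a, Φ u (q a) = ∑ k, a k • u.1 k := fun u a => by rw [hΦ', hlin]
  have hcont : Continuous Φ := by
    rw [(isInducing_toContinuousMap (A := A) (M := M) (U := U)).continuous_iff]
    refine ContinuousMap.continuous_of_continuous_uncurry _ ?_
    -- Joint continuity can be tested on `S × A ^ n`, where the map is an explicit sum.
    rw [← (IsOpenQuotientMap.id.prodMap hqo).continuous_comp_iff]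
    have h : Continuous fun p : S × (Fin n → A) => ∑ k, p.2 k • p.1.1 k :=
      continuous_finsetSum _ fun k _ => ((continuous_apply k).comp continuous_snd).smul
        ((continuous_apply k).comp (continuous_subtype_val.comp continuous_fst))
    exact h.congr fun p => (hΦ p.1 p.2).symm
  have hsum : ∀ (f : M →ₗ[A] U) (a : Fin n → A),
      ∑ k, a k • f (q (Pi.single k 1)) = f (q a) := fun f a => by
    conv_rhs => rw [pi_eq_sum_univ' a]
    simp [map_sum]
  have hsurj : Function.Surjective Φ := by
    intro f
    refine ⟨⟨fun k => f (q (Pi.single k 1)), fun a ha => ?_⟩, ?_⟩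
    · rw [hsum, ha, map_zero]
    · refine LinearMap.ext fun m => ?_
      obtain ⟨a, rfl⟩ := hq m
      rw [hΦ, hsum]
  exact hsurj.compactSpace hcont

end HomSpace

section End

variable {A : Type*} [Ring A] [TopologicalSpace A] [IsTopologicalRing A] [CompactSpace A]
variable {M : Type*} [AddCommGroup M] [Module A M] [TopologicalSpace M] [IsModuleTopology A M]
  [Module.Finite A M]

theorem end_isTopologicalRing : IsTopologicalRing (Module.End A M) where
  continuous_add := by
    have := IsModuleTopology.topologicalAddGroup A M
    exact continuous_add (M := M →ₗ[A] M)
  continuous_neg := by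
    have := IsModuleTopology.topologicalAddGroup A M
    exact continuous_neg (G := M →ₗ[A] M)
  continuous_mul := by
    have := IsModuleTopology.toContinuousAdd A M
    have := hom_continuousSMul (A := A) (M := M) (U := M)
    have h : Continuous fun p : Module.End A M × Module.End A M =>
        (MulOpposite.op p.2 • (p.1 : M →ₗ[A] M) : M →ₗ[A] M) :=
      (MulOpposite.continuous_op.comp continuous_snd).smul continuous_fst
    exact h

end End

/-! ### Local endomorphism rings -/

/-- In a compact Hausdorff ring without nontrivial idempotents, `f` or `1 - f` is a unit. -/
theorem isUnit_or_isUnit_one_sub {E : Type*} [Ring E] [TopologicalSpace E] [IsTopologicalRing E]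
    [CompactSpace E] [T2Space E] (h : ∀ e : E, e * e = e → e = 0 ∨ e = 1) (f : E) :
    IsUnit f ∨ IsUnit (1 - f) := by
  have hl : ∀ a : E, IsClosed (Set.range fun x => a * x) := fun a =>
    (isCompact_range (continuous_const_mul a)).isClosed
  have hr : ∀ a : E, IsClosed (Set.range fun x => x * a) := fun a =>
    (isCompact_range (continuous_mul_const a)).isClosed
  -- A closed multiplicative semigroup containing `f`, by `1 - ab = (1 - a) b + (1 - b) = a (1 - b)
  -- + (1 - a)`. Its idempotent is 0 or 1: 0 inverts `1 - f` and 1 inverts `f`.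
  let T : Set E := {g | ((g ∈ Set.range fun x => f * x) ∧ g ∈ Set.range fun x => x * f) ∧
    (1 - g ∈ Set.range fun x => (1 - f) * x) ∧ 1 - g ∈ Set.range fun x => x * (1 - f)}
  have hT : IsClosed T := by
    have hs : Continuous fun g : E => 1 - g := by fun_prop
    exact ((hl f).inter (hr f)).inter (((hl _).preimage hs).inter ((hr _).preimage hs))
  obtain ⟨e, ⟨⟨⟨x, hx⟩, ⟨y, hy⟩⟩, ⟨z, hz⟩, ⟨t, ht⟩⟩, he⟩ :=
    exists_idempotent_in_compact_subsemigroup (fun r => continuous_mul_const r) T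
      ⟨f, ⟨⟨1, mul_one f⟩, ⟨1, one_mul f⟩⟩, ⟨1, mul_one _⟩, ⟨1, one_mul _⟩⟩ hT.isCompact (by
        rintro a ⟨⟨⟨x, hx⟩, -⟩, ⟨z, hz⟩, ⟨t, ht⟩⟩ b ⟨⟨-, ⟨y', hy'⟩⟩, ⟨z', hz'⟩, ⟨t', ht'⟩⟩
        dsimp only at *
        refine ⟨⟨⟨x * b, ?_⟩, ⟨a * y', ?_⟩⟩, ⟨z * b + z', ?_⟩, ⟨a * t' + t, ?_⟩⟩
        · dsimp only
          rw [← mul_assoc, hx]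
        · dsimp only
          rw [mul_assoc, hy']
        · dsimp only
          rw [mul_add, ← mul_assoc, hz, hz']
          noncomm_ring
        · dsimp only
          rw [add_mul, mul_assoc, ht, ht']
          noncomm_ring)
  rcases h e he with rfl | rfl
  · right
    rw [sub_zero] at hz ht
    exact isUnit_iff_exists_and_exists.2 ⟨⟨z, hz⟩, ⟨t, ht⟩⟩
  · left
    exact isUnit_iff_exists_and_exists.2 ⟨⟨x, hx⟩, ⟨y, hy⟩⟩

theorem IsIndecomposable.eq_zero_or_eq_one {A : Type*} [Ring A] {M : Type*} [AddCommGroup M]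
    [Module A M] (h : IsIndecomposable A M) (e : Module.End A M) (he : e * e = e) :
    e = 0 ∨ e = 1 := by
  have hc := LinearMap.IsIdempotentElem.isCompl (f := e) he
  rcases h.2 _ _ hc with h1 | h1
  · exact Or.inl (LinearMap.range_eq_bot.1 h1)
  · refine Or.inr (LinearMap.ext fun x => ?_)
    exact LinearMap.ker_eq_bot.1 h1 (LinearMap.congr_fun he x)

theorem IsIndecomposable.isUnit_or_isUnit_one_sub {A : Type*} [Ring A] [TopologicalSpace A]
    [IsTopologicalRing A] [CompactSpace A] [T2Space A] [IsNoetherianRing A] {M : Type*}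
    [AddCommGroup M] [Module A M] [TopologicalSpace M] [IsModuleTopology A M] [Module.Finite A M]
    (h : IsIndecomposable A M) (f : Module.End A M) : IsUnit f ∨ IsUnit (1 - f) := by
  have := t2Space_of_finite (A := A) (N := M)
  have := compactSpace_of_finite (A := A) (M := M)
  have := IsModuleTopology.topologicalAddGroup A M
  have := end_isTopologicalRing (A := A) (M := M)
  have : CompactSpace (Module.End A M) := hom_compactSpace
  have : T2Space (Module.End A M) := hom_t2Space
  exact ProfMod.isUnit_or_isUnit_one_sub h.eq_zero_or_eq_one f

/-! ### Group rings -/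

section GroupRing

variable {R : Type*} {G : Type*} [CommRing R] [TopologicalSpace R]

theorem continuous_groupRing_coeff :
    Continuous fun (x : MonoidAlgebra R G) (g : G) => x.coeff g :=
  continuous_pi continuous_coeff

theorem groupRing_coeff_injective :
    Function.Injective fun (x : MonoidAlgebra R G) (g : G) => x.coeff g := fun x y h => by
  ext g
  exact congrFun h g

instance groupRing_t2Space [T2Space R] : T2Space (MonoidAlgebra R G) :=
  T2Space.of_injective_continuous groupRing_coeff_injective continuous_groupRing_coeff

instance groupRing_totallyDisconnectedSpace [TotallyDisconnectedSpace R] :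
    TotallyDisconnectedSpace (MonoidAlgebra R G) :=
  ⟨isTotallyDisconnected_of_image continuous_groupRing_coeff.continuousOn
    groupRing_coeff_injective (isTotallyDisconnected_of_totallyDisconnectedSpace _)⟩

end GroupRing

theorem groupRing_isNoetherianRing (R G : Type*) [CommRing R] [IsNoetherianRing R] [Group G]
    [Finite G] : IsNoetherianRing (MonoidAlgebra R G) := by
  have : Module.Finite R (MonoidAlgebra R G) := by infer_instance
  exact IsNoetherianRing.of_finite R _

/-- A finitely generated module over the group ring of a finite group is finitely generated over
its endomorphism ring. -/
theorem finite_end_of_groupRing {R G : Type*} [CommRing R] [Group G]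
    [Finite G] (N : Type*) [AddCommGroup N] [Module (MonoidAlgebra R G) N]
    [Module.Finite (MonoidAlgebra R G) N] : Module.Finite (Module.End (MonoidAlgebra R G) N) N := by
  cases nonempty_fintype G
  obtain ⟨n, b, hb⟩ := Module.Finite.exists_fin (R := MonoidAlgebra R G) (M := N)
  -- Scalars from `R` are central, so they act by endomorphisms; hence the finitely many translates
  -- `g • b i` suffice as generators.
  let sc : R → Module.End (MonoidAlgebra R G) N := fun r =>
    { toFun := fun n => algebraMap R (MonoidAlgebra R G) r • n
      map_add' := smul_add _
      map_smul' := fun a n => by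
        rw [RingHom.id_apply, ← mul_smul, ← mul_smul, Algebra.commutes] }
  have ha : ∀ a : MonoidAlgebra R G,
      a = ∑ g, algebraMap R _ (a.coeff g) * MonoidAlgebra.single g 1 := by
    intro a
    classical
    ext g
    simp [MonoidAlgebra.coeff_sum]
  refine Module.Finite.of_fg_top (Submodule.fg_def.2
    ⟨Set.range fun x : Fin n × G => MonoidAlgebra.single x.2 (1 : R) • b x.1,
      Set.finite_range _, ?_⟩)
  rw [eq_top_iff]
  rintro x -
  obtain ⟨c, rfl⟩ := (Submodule.mem_span_range_iff_exists_fun _).1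
    (hb ▸ Submodule.mem_top : x ∈ Submodule.span (MonoidAlgebra R G) (Set.range b))
  refine Submodule.sum_mem _ fun i _ => ?_
  rw [ha (c i), Finset.sum_smul]
  refine Submodule.sum_mem _ fun g _ => ?_
  rw [mul_smul]
  exact Submodule.smul_mem _ (sc ((c i).coeff g)) (Submodule.subset_span ⟨(i, g), rfl⟩)

/-- Elements are the sums of their expansions in a topological dual basis. -/
theorem TopDualBasis.hasSum {B : Type*} [Ring B] [TopologicalSpace B] [IsTopologicalRing B]
    [T2Space B] {P : Type*} [AddCommGroup P] [Module B P] [TopologicalSpace P]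
    [IsTopologicalAddGroup P] [ContinuousSMul B P] [CompactSpace P] {I : Type*} {e : I → B}
    (b : TopDualBasis B P e) (p : P) : HasSum (fun x => b.coord x p • b.vec x) p := by
  classical
  rw [HasSum, SummationFilter.unconditional_filter, tendsto_atTop_nhds]
  intro W hpW hW
  obtain ⟨F, hF⟩ := b.exists_finset (W := (fun q => p - q) ⁻¹' W) (hW.preimage (by fun_prop))
    (by simpa using hpW)
  refine ⟨F, fun F' hF' => ?_⟩
  have h := hF (p - ∑ x ∈ F', b.coord x p • b.vec x) fun x hx => b.coord_sub_sum F' p (hF' hx)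
  simpa using h

/-! ### Products of the summands and full faithfulness -/

section Add

variable {A : Type*} [Ring A] [TopologicalSpace A] [IsTopologicalRing A] [CompactSpace A]
variable {ι : Type} [Fintype ι] [DecidableEq ι] {M : ι → Type w} [∀ i, AddCommGroup (M i)]
  [∀ i, Module A (M i)] [∀ i, TopologicalSpace (M i)] [∀ i, IsModuleTopology A (M i)]
  [∀ i, Module.Finite A (M i)]
variable {U : Type w} [AddCommGroup U] [Module A U] [TopologicalSpace U]
variable {κ : ι → Type w}

variable (A M) in
/-- The idempotent endomorphism of `∏ i, M i` projecting to the factor `M i`, in the opposite of the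
endomorphism ring. -/
def factorIdempotent (i : ι) : (Module.End A (∀ i, M i))ᵐᵒᵖ :=
  MulOpposite.op (LinearMap.single A M i ∘ₗ LinearMap.proj i)

theorem factorIdempotent_mul_self (i : ι) :
    factorIdempotent A M i * factorIdempotent A M i = factorIdempotent A M i := by
  refine MulOpposite.unop_injective (LinearMap.ext fun m => ?_)
  simp [factorIdempotent]

theorem sum_factorIdempotent : ∑ i, factorIdempotent A M i = 1 := by
  refine MulOpposite.unop_injective (LinearMap.ext fun m => ?_)
  rw [Finset.unop_sum, LinearMap.sum_apply]
  exact LinearMap.sum_single_apply M m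

/-- The ring `e * E * e` is local if `e` is the idempotent of an indecomposable factor. -/
theorem exists_mul_factorIdempotent [T2Space A] [IsNoetherianRing A] {i : ι}
    (h : IsIndecomposable A (M i)) (r : (Module.End A (∀ i, M i))ᵐᵒᵖ) :
    ∃ v, v * (factorIdempotent A M i * r * factorIdempotent A M i) = factorIdempotent A M i ∨
      v * (factorIdempotent A M i - factorIdempotent A M i * r * factorIdempotent A M i) =
        factorIdempotent A M i := by
  let ρ : Module.End A (M i) := LinearMap.proj i ∘ₗ r.unop ∘ₗ LinearMap.single A M i
  rcases h.isUnit_or_isUnit_one_sub ρ with hu | hu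
  -- A right inverse here becomes a left inverse in the opposite ring.
  · obtain ⟨σ, hσ⟩ := hu.exists_right_inv
    refine ⟨MulOpposite.op (LinearMap.single A M i ∘ₗ σ ∘ₗ LinearMap.proj i), Or.inl ?_⟩
    refine MulOpposite.unop_injective (LinearMap.ext fun m => ?_)
    have := LinearMap.congr_fun hσ (m i)
    simp [ρ] at this
    simp [factorIdempotent, this]
  · obtain ⟨σ, hσ⟩ := hu.exists_right_inv
    refine ⟨MulOpposite.op (LinearMap.single A M i ∘ₗ σ ∘ₗ LinearMap.proj i), Or.inr ?_⟩
    refine MulOpposite.unop_injective (LinearMap.ext fun m => ?_)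
    have := LinearMap.congr_fun hσ (m i)
    simp [ρ] at this
    simp [factorIdempotent, ← Pi.single_sub, this]

/-- The inclusion of a factor. -/
noncomputable def inclFactor (ψ : U ≃L[A] (∀ i, κ i → M i)) (x : Σ i, κ i) : M x.1 →ₗ[A] U :=
  open Classical in
  ψ.symm.toLinearMap ∘ₗ LinearMap.single A (fun i => κ i → M i) x.1 ∘ₗ
    LinearMap.single A (fun _ => M x.1) x.2

/-- The projection to a factor. -/
def projFactor (ψ : U ≃L[A] (∀ i, κ i → M i)) (x : Σ i, κ i) : U →L[A] M x.1 :=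
  (ContinuousLinearMap.proj x.2).comp ((ContinuousLinearMap.proj x.1).comp ψ.toContinuousLinearMap)

theorem projFactor_inclFactor (ψ : U ≃L[A] (∀ i, κ i → M i)) (x : Σ i, κ i) (m : M x.1) :
    projFactor ψ x (inclFactor ψ x m) = m := by
  simp [projFactor, inclFactor]

theorem projFactor_inclFactor_of_ne (ψ : U ≃L[A] (∀ i, κ i → M i)) {x y : Σ i, κ i} (h : x ≠ y)
    (m : M y.1) : projFactor ψ x (inclFactor ψ y m) = 0 := by
  classical
  obtain ⟨i, k⟩ := x
  obtain ⟨j, l⟩ := y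
  by_cases hij : i = j
  · subst hij
    have hkl : k ≠ l := fun hkl => h (by rw [hkl])
    simp [projFactor, inclFactor, hkl]
  · simp [projFactor, inclFactor, hij]

theorem eq_zero_of_projFactor (ψ : U ≃L[A] (∀ i, κ i → M i)) {u : U}
    (h : ∀ x, projFactor ψ x u = 0) : u = 0 := by
  apply ψ.injective
  rw [map_zero]
  funext i k
  exact h ⟨i, k⟩

/-- The projection to a factor, as a homomorphism to `∏ i, M i`. -/
noncomputable def projSummand (ψ : U ≃L[A] (∀ i, κ i → M i)) (x : Σ i, κ i) : U →L[A] (∀ i, M i) :=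
  (ContinuousLinearMap.single A M x.1).comp (projFactor ψ x)

variable [IsTopologicalAddGroup U] [ContinuousSMul A U]

/-- The topological dual basis of `Hom(∏ i, M i, U)` given by an isomorphism of `U` with a product
of copies of the `M i`. -/
noncomputable def homDualBasis (ψ : U ≃L[A] (∀ i, κ i → M i)) :
    TopDualBasis (Module.End A (∀ i, M i))ᵐᵒᵖ ((∀ i, M i) →ₗ[A] U)
      (fun x : Σ i, κ i => factorIdempotent A M x.1) where
  vec x := inclFactor ψ x ∘ₗ LinearMap.proj x.1
  coord x :=
    { toFun := fun f => MulOpposite.op ((projSummand ψ x).toLinearMap ∘ₗ f)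
      map_add' := fun f g => MulOpposite.unop_injective (LinearMap.ext fun m =>
        map_add (projSummand ψ x) (f m) (g m))
      map_smul' := fun _ _ => rfl
      cont := by
        have h := (postcomp (∀ i, M i) (projSummand ψ x)).continuous
        exact MulOpposite.continuous_op.comp h }
  coord_vec_self x := by
    refine MulOpposite.unop_injective (LinearMap.ext fun m => ?_)
    change Pi.single x.1 (projFactor ψ x (inclFactor ψ x (m x.1))) = Pi.single x.1 (m x.1)
    rw [projFactor_inclFactor]
  coord_vec_ne x y h := by
    refine MulOpposite.unop_injective (LinearMap.ext fun m => ?_)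
    change Pi.single x.1 (projFactor ψ x (inclFactor ψ y (m y.1))) = 0
    rw [projFactor_inclFactor_of_ne ψ h, Pi.single_zero]
  coord_mul x f := by
    refine MulOpposite.unop_injective (LinearMap.ext fun m => ?_)
    change Pi.single x.1 (Pi.single x.1 (projFactor ψ x (f m)) x.1) =
      Pi.single x.1 (projFactor ψ x (f m))
    rw [Pi.single_eq_same]
  eq_zero f h := by
    refine LinearMap.ext fun m => eq_zero_of_projFactor ψ fun x => ?_
    have := LinearMap.congr_fun (congrArg MulOpposite.unop (h x)) m
    change Pi.single x.1 (projFactor ψ x (f m)) = 0 at this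
    rwa [Pi.single_eq_zero_iff] at this

/-- If the `M i` are finite over their endomorphism rings, products of copies of them are generated
by the images of finitely many elements under homomorphisms. -/
theorem exists_sum_hom_apply_eq (hfin : ∀ i, Module.Finite (Module.End A (M i)) (M i))
    (ψ : U ≃L[A] (∀ i, κ i → M i)) :
    ∃ (n : ι → ℕ) (b : (Σ i, Fin (n i)) → ∀ i, M i), ∀ u : U,
      ∃ f : (Σ i, Fin (n i)) → ((∀ i, M i) →ₗ[A] U), ∑ j, f j (b j) = u := by
  choose n b hb using fun i => Module.Finite.exists_fin (R := Module.End A (M i)) (M := M i)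
  have hc : ∀ i (m : M i), ∃ c : Fin (n i) → Module.End A (M i), ∑ k, c k • b i k = m :=
    fun i m => (Submodule.mem_span_range_iff_exists_fun _).1 (hb i ▸ Submodule.mem_top)
  choose c hc using hc
  -- The same generators of `M i` serve all copies at once: the `k`-th homomorphism gathers the
  -- `k`-th coefficients of all components of `u`.
  refine ⟨n, fun j => Pi.single j.1 (b j.1 j.2), fun u => ⟨fun j => ψ.symm.toLinearMap ∘ₗ
    LinearMap.single A (fun i => κ i → M i) j.1 ∘ₗ
    (LinearMap.pi fun x => c j.1 (ψ u j.1 x) j.2) ∘ₗ LinearMap.proj j.1, ?_⟩⟩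
  apply ψ.injective
  rw [map_sum, Fintype.sum_sigma]
  have h : ∀ i, ∑ k, ψ (ψ.symm (Pi.single i fun x => c i (ψ u i x) k (b i k))) =
      (Pi.single i (ψ u i) : ∀ i, κ i → M i) := by
    intro i
    simp only [ContinuousLinearEquiv.apply_symm_apply]
    refine (map_sum (LinearMap.single A (fun i => κ i → M i) i)
      (fun k x => c i (ψ u i x) k (b i k)) Finset.univ).symm.trans
      (congrArg (Pi.single i) (funext fun x => ?_))
    rw [Finset.sum_apply]
    exact hc i (ψ u i x)
  refine Eq.trans (Finset.sum_congr rfl fun i _ => ?_) (Finset.univ_sum_single (ψ u))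
  refine Eq.trans (Finset.sum_congr rfl fun k _ => ?_) (h i)
  change ψ (ψ.symm (Pi.single i fun x => c i (ψ u i x) k (Pi.single i (b i k) i))) = _
  rw [Pi.single_eq_same]

variable {V : Type w} [AddCommGroup V] [Module A V] [TopologicalSpace V]

theorem ext_of_hom_apply (hfin : ∀ i, Module.Finite (Module.End A (M i)) (M i))
    (ψ : U ≃L[A] (∀ i, κ i → M i)) {α β : U →L[A] V}
    (h : ∀ (f : (∀ i, M i) →ₗ[A] U) m, α (f m) = β (f m)) : α = β := by
  obtain ⟨n, b, hb⟩ := exists_sum_hom_apply_eq hfin ψ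
  ext u
  obtain ⟨f, rfl⟩ := hb u
  simp [map_sum, h]

/-- Continuous homomorphisms of right modules `Hom(M, U) → Hom(M, V)` are given by composition with
continuous homomorphisms `U → V`. -/
theorem exists_hom_apply_eq [T2Space (∀ i, M i)] [CompactSpace U] [T2Space U]
    [IsTopologicalAddGroup V] [ContinuousSMul A V] [T2Space V]
    (hfin : ∀ i, Module.Finite (Module.End A (M i)) (M i)) (ψ : U ≃L[A] (∀ i, κ i → M i))
    (φ : ((∀ i, M i) →ₗ[A] U) →L[(Module.End A (∀ i, M i))ᵐᵒᵖ] ((∀ i, M i) →ₗ[A] V)) :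
    ∃ α : U →L[A] V, ∀ f m, α (f m) = φ f m := by
  obtain ⟨n, b, hb⟩ := exists_sum_hom_apply_eq hfin ψ
  have := end_isTopologicalRing (A := A) (M := ∀ i, M i)
  have := hom_compactSpace (A := A) (M := ∀ i, M i) (U := U)
  have : T2Space (Module.End A (∀ i, M i)) := hom_t2Space
  have := hom_continuousSMul (A := A) (M := ∀ i, M i) (U := U)
  let ev : (((∀ i, M i) →ₗ[A] U) →₀ (∀ i, M i)) →ₗ[A] U := Finsupp.lsum ℕ fun f => f
  let evφ : (((∀ i, M i) →ₗ[A] U) →₀ (∀ i, M i)) →ₗ[A] V := Finsupp.lsum ℕ fun f => φ f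
  have hev : ∀ f m, ev (Finsupp.single f m) = f m := fun f m => Finsupp.lsum_single _ _ _ _
  have hevφ : ∀ f m, evφ (Finsupp.single f m) = φ f m := fun f m => Finsupp.lsum_single _ _ _ _
  have hsurj : Function.Surjective ev := fun u => by
    obtain ⟨f, rfl⟩ := hb u
    exact ⟨∑ j, Finsupp.single (f j) (b j), by simp [map_sum, hev]⟩
  -- The terms depend on `z` only through `ev z`, so `evφ` vanishes on the kernel of `ev` by
  -- uniqueness of sums.
  have hsum : ∀ z, HasSum (fun x => φ ((homDualBasis ψ).vec x) (projSummand ψ x (ev z)))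
      (evφ z) := by
    intro z
    induction z using Finsupp.induction_linear with
    | zero => simp
    | add z z' h h' => simpa only [map_add] using h.add h'
    | single f m =>
      rw [hev, hevφ]
      have h := (((homDualBasis ψ).hasSum f).map φ φ.continuous).map
        (LinearMap.applyₗ' ℕ m : ((∀ i, M i) →ₗ[A] V) →ₗ[ℕ] V) (continuous_hom_apply m)
      refine Eq.mp (congrArg (HasSum · (φ f m)) (funext fun x => ?_)) h
      change φ ((homDualBasis ψ).coord x f • (homDualBasis ψ).vec x) m = _
      rw [map_smul]
      rfl
  obtain ⟨α, hα⟩ := exists_linearMap_comp_eq hsurj evφ fun z hz => by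
    have h := hsum z
    simp only [hz, map_zero] at h
    exact h.unique hasSum_zero
  have hαf : ∀ f m, α (f m) = φ f m := fun f m => by rw [← hev, hα, hevφ]
  let θ : ((Σ i, Fin (n i)) → ((∀ i, M i) →ₗ[A] U)) → U := fun f => ∑ j, f j (b j)
  have hθ : Continuous θ := continuous_finsetSum _ fun j _ =>
    (continuous_hom_apply (b j)).comp (continuous_apply j)
  -- A continuous surjection from a compact space to a Hausdorff one is a quotient map, so
  -- continuity of `α` can be tested after `θ`.
  have hq : Topology.IsQuotientMap θ := hθ.isClosedMap.isQuotientMap hθ hb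
  refine ⟨⟨α, ?_⟩, hαf⟩
  change Continuous α
  rw [hq.continuous_iff]
  have h : Continuous fun f : (Σ i, Fin (n i)) → ((∀ i, M i) →ₗ[A] U) => ∑ j, φ (f j) (b j) :=
    continuous_finsetSum _ fun j _ =>
      (continuous_hom_apply (b j)).comp (φ.continuous.comp (continuous_apply j))
  exact h.congr fun f => by simp [θ, map_sum, hαf]

end Add

/-! ### Objects of the two categories -/

section IsAdd

variable {A : Type*} [Ring A] [TopologicalSpace A] [IsTopologicalRing A] [CompactSpace A]
  [T2Space A] [TotallyDisconnectedSpace A] [IsNoetherianRing A]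
variable {s : ℕ} {M : Fin s → Type w} [∀ i, AddCommGroup (M i)]
  [∀ i, Module A (M i)] [∀ i, TopologicalSpace (M i)] [∀ i, IsModuleTopology A (M i)]
  [∀ i, Module.Finite A (M i)]

theorem isProfinite_of_equiv {U : TopModuleCat.{w} A} {κ : Fin s → Type w}
    (ψ : U ≃L[A] (∀ i, κ i → M i)) : IsProfinite U := by
  have := fun i => compactSpace_of_finite (A := A) (M := M i)
  have := fun i => t2Space_of_finite (A := A) (N := M i)
  have := fun i => totallyDisconnectedSpace_of_finite (A := A) (N := M i)
  refine ⟨ψ.toHomeomorph.symm.compactSpace, ψ.toHomeomorph.symm.t2Space, ⟨?_⟩⟩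
  exact isTotallyDisconnected_of_image ψ.continuous.continuousOn ψ.injective
    (isTotallyDisconnected_of_totallyDisconnectedSpace _)

/-- `Hom(M, U)` is a profinite projective module for `U` in `Add(M)`. -/
theorem isProfiniteProjective_homFunctor_obj {U : TopModuleCat.{w} A} (hU : IsAdd A M U) :
    IsProfiniteProjective.{w, w} (Module.End A (∀ i, M i))ᵐᵒᵖ
      ((homFunctor A (∀ i, M i)).obj U) := by
  obtain ⟨κ, ⟨ψ⟩⟩ := hU
  obtain ⟨_, _, _⟩ := isProfinite_of_equiv ψ
  have := t2Space_of_finite (A := A) (N := ∀ i, M i)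
  have := compactSpace_of_finite (A := A) (M := ∀ i, M i)
  have := IsModuleTopology.topologicalAddGroup A (∀ i, M i)
  have := end_isTopologicalRing (A := A) (M := ∀ i, M i)
  have : CompactSpace (Module.End A (∀ i, M i)) := hom_compactSpace
  have : T2Space (Module.End A (∀ i, M i)) := hom_t2Space
  have hc := hom_compactSpace (A := A) (M := ∀ i, M i) (U := U)
  have := hom_continuousSMul (A := A) (M := ∀ i, M i) (U := U)
  refine ⟨⟨hc, hom_t2Space, hom_totallyDisconnectedSpace⟩, fun X Y hX hY p f hp => ?_⟩
  obtain ⟨_, _, _⟩ := hX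
  obtain ⟨_, _, _⟩ := hY
  obtain ⟨g, hg⟩ := (homDualBasis ψ).exists_lift p.hom hp f.hom
  exact ⟨TopModuleCat.ofHom g, ConcreteCategory.hom_ext _ _ hg⟩

/-- Every profinite projective right `End(M)`-module is of the form `Hom(M, U)` with `U` in `Add(M)`
if the summands of `M` are indecomposable. -/
theorem exists_homFunctor_obj_equiv (hindec : ∀ i, IsIndecomposable A (M i))
    {P : TopModuleCat.{w} (Module.End A (∀ i, M i))ᵐᵒᵖ}
    (hP : IsProfiniteProjective.{w, w} (Module.End A (∀ i, M i))ᵐᵒᵖ P) :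
    ∃ U : TopModuleCat.{w} A, IsAdd A M U ∧
      Nonempty ((homFunctor A (∀ i, M i)).obj U ≅ P) := by
  obtain ⟨⟨_, _, _⟩, hproj⟩ := hP
  have := t2Space_of_finite (A := A) (N := ∀ i, M i)
  have := compactSpace_of_finite (A := A) (M := ∀ i, M i)
  have := IsModuleTopology.topologicalAddGroup A (∀ i, M i)
  have := end_isTopologicalRing (A := A) (M := ∀ i, M i)
  have : CompactSpace (Module.End A (∀ i, M i)) := hom_compactSpace
  have : T2Space (Module.End A (∀ i, M i)) := hom_t2Space
  obtain ⟨κ, hκ⟩ := exists_projective_cover (P := P) (factorIdempotent A M)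
    factorIdempotent_mul_self sum_factorIdempotent
    (fun i => exists_mul_factorIdempotent (hindec i))
  have := fun i => IsModuleTopology.topologicalAddGroup A (M i)
  let U : TopModuleCat.{w} A := TopModuleCat.of A (∀ i, κ i → M i)
  let ψ : U ≃L[A] (∀ i, κ i → M i) := ContinuousLinearEquiv.refl A _
  obtain ⟨_, _, _⟩ := isProfinite_of_equiv ψ
  refine ⟨U, ⟨κ, ⟨ψ⟩⟩, ?_⟩
  have hc := hom_compactSpace (A := A) (M := ∀ i, M i) (U := U)
  have := hom_continuousSMul (A := A) (M := ∀ i, M i) (U := U)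
  obtain ⟨g, hgs, hgi⟩ := hκ ((∀ i, M i) →ₗ[A] U) (homDualBasis ψ)
  -- Lifting the identity of `P` splits the cover, which is therefore bijective, and a homeomorphism
  -- by compactness.
  obtain ⟨t, ht⟩ := hproj ((homFunctor A (∀ i, M i)).obj U) P
    ⟨hc, hom_t2Space, hom_totallyDisconnectedSpace⟩ ⟨‹_›, ‹_›, ‹_›⟩
    (TopModuleCat.ofHom g) (𝟙 P) hgs
  have hinj : Function.Injective g := hgi t.hom fun p => ConcreteCategory.congr_hom ht p
  let e : ((∀ i, M i) →ₗ[A] U) ≃ₗ[(Module.End A (∀ i, M i))ᵐᵒᵖ] P :=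
    LinearEquiv.ofBijective g.toLinearMap ⟨hinj, hgs⟩
  have hcl : Topology.IsClosedEmbedding e := g.continuous.isClosedEmbedding hinj
  let e' : ((∀ i, M i) →ₗ[A] U) ≃L[(Module.End A (∀ i, M i))ᵐᵒᵖ] P :=
    { e with
      continuous_toFun := g.continuous
      continuous_invFun :=
        (Equiv.toHomeomorphOfIsInducing e.toEquiv hcl.isInducing).symm.continuous }
  exact ⟨TopModuleCat.ofIso (X := (homFunctor A (∀ i, M i)).obj U) e'⟩

end IsAdd

end ProfMod

/-- With `A = RG`, `M = ⨁ i, M i` and `E = End_{RG}(M)`, the functor `Hom_{RG}(M, -)` maps `Add(M)`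
into the profinite projective right `E`-modules, and is an equivalence between these two categories
(with continuous homomorphisms as morphisms). -/
theorem proposition2p1
    {R : Type u} [CommRing R] [TopologicalSpace R] [IsTopologicalRing R]
    [CompactSpace R] [T2Space R] [TotallyDisconnectedSpace R] [IsLocalRing R] [IsNoetherianRing R]
    {G : Type v} [Group G] [Finite G]
    {s : ℕ} (M : Fin s → Type w) [∀ i, AddCommGroup (M i)] [∀ i, Module (MonoidAlgebra R G) (M i)]
    [∀ i, TopologicalSpace (M i)] [∀ i, IsModuleTopology (MonoidAlgebra R G) (M i)]
    [∀ i, Module.Finite (MonoidAlgebra R G) (M i)]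
    (hindec : ∀ i, ProfMod.IsIndecomposable (MonoidAlgebra R G) (M i))
    (hnoniso : ∀ i j, i ≠ j → IsEmpty (M i ≃ₗ[MonoidAlgebra R G] M j)) :
    ∃ h : ∀ U : (ProfMod.IsAdd (MonoidAlgebra R G) M).FullSubcategory,
        ProfMod.IsProfiniteProjective (Module.End (MonoidAlgebra R G) (∀ i, M i))ᵐᵒᵖ
          ((ProfMod.homFunctor (MonoidAlgebra R G) (∀ i, M i)).obj U.obj),
      ((ProfMod.IsProfiniteProjective.{w, w}
          (Module.End (MonoidAlgebra R G) (∀ i, M i))ᵐᵒᵖ).lift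
        ((ProfMod.IsAdd (MonoidAlgebra R G) M).ι ⋙
          ProfMod.homFunctor (MonoidAlgebra R G) (∀ i, M i)) h).IsEquivalence := by
  have := ProfMod.groupRing_isNoetherianRing R G
  have hfin := fun i => ProfMod.finite_end_of_groupRing (R := R) (G := G) (M i)
  refine ⟨fun U => ProfMod.isProfiniteProjective_homFunctor_obj U.property,
    { faithful := ⟨fun {U V α β} h => ?_⟩, full := ⟨fun {U V} φ => ?_⟩,
      essSurj := ⟨fun P => ?_⟩ }⟩
  · obtain ⟨κ, ⟨ψ⟩⟩ := U.property
    refine ObjectProperty.hom_ext _ (ConcreteCategory.hom_ext _ _ fun u => ?_)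
    have h' : α.hom.hom = β.hom.hom := ProfMod.ext_of_hom_apply hfin ψ fun f m => by
      have h1 := ConcreteCategory.congr_hom (congrArg InducedCategory.Hom.hom h) f
      exact LinearMap.congr_fun h1 m
    exact congrArg (fun γ : U.obj →L[MonoidAlgebra R G] V.obj => γ u) h'
  · obtain ⟨κ, ⟨ψ⟩⟩ := U.property
    obtain ⟨κ', ⟨ψ'⟩⟩ := V.property
    obtain ⟨_, _, _⟩ := ProfMod.isProfinite_of_equiv ψ
    obtain ⟨_, _, _⟩ := ProfMod.isProfinite_of_equiv ψ'
    have := ProfMod.t2Space_of_finite (A := MonoidAlgebra R G) (N := ∀ i, M i)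
    let φ' : ((∀ i, M i) →ₗ[MonoidAlgebra R G] U.obj)
        →L[(Module.End (MonoidAlgebra R G) (∀ i, M i))ᵐᵒᵖ]
        ((∀ i, M i) →ₗ[MonoidAlgebra R G] V.obj) := φ.hom.hom
    obtain ⟨α, hα⟩ := ProfMod.exists_hom_apply_eq hfin ψ φ'
    refine ⟨ObjectProperty.homMk (TopModuleCat.ofHom α), ?_⟩
    refine ObjectProperty.hom_ext _ (ConcreteCategory.hom_ext _ _ fun f => ?_)
    exact LinearMap.ext fun m => hα f m
  · obtain ⟨U, hU, ⟨e⟩⟩ := ProfMod.exists_homFunctor_obj_equiv hindec P.property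
    exact ⟨⟨U, hU⟩, ⟨ObjectProperty.isoMk _ e⟩⟩
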